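/- Let $E$ be the set of Borel measures $\varphi$ on $\mathbb{R}$ with values in $\{0,1,2,\dots,\infty\}$ that are finite on bounded Borel sets, with the $\sigma$-field $\mathcal{E}$ generated by the sets $\{\varphi:\varphi(B)=k\}$ ($B$ Borel, $k\in\mathbb{Z}$). Let $M=\{\varphi\in E:\varphi(\mathbb{R})>0,\ \varphi\{y\}\le 1\text{ for all }y\in\mathbb{R}\}$ and $M^\infty=\{\varphi\in M:\varphi(-\infty,0]=\varphi(0,\infty)=\infty\}$, with the trace $\sigma$-fields $\mathcal{M}=M\cap\mathcal{E}$ and $\mathcal{M}^\infty=M^\infty\cap\mathcal{M}$. The points of $\varphi\in M$ are numbered $\cdots<T_{-1}(\varphi)<T_0(\varphi)\le 0<T_1(\varphi)<T_2(\varphi)<\cdots$. Put $\theta_y\varphi=\varphi(y+\cdot)$ for $y\in\mathbb{R}$ and, if $|T_n(\varphi)|<\infty$, $\eta_n\varphi=\varphi(T_n(\varphi)+\cdot)$ for $n\in\mathbb{Z}$. Let $\mathcal{I}=\{A\in\mathcal{M}^\infty:\eta_1^{-1}A=A\}$ be the invariant $\sigma$-field. A point process distribution is a probability measure $P$ on $(M,\mathcal{M})$.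 It is time-stationary (TS) if $P(\theta_y^{-1}A)=P(A)$ for all $y\in\mathbb{R}$, $A\in\mathcal{M}$, and event-stationary (ES) if $P(M^\infty)=1$ and $P(\eta_1^{-1}A)=P(A)$ for all $A\in\mathcal{M}^\infty$. For point process distributions $P,P_{ts},P_{es}$ with $P(M^\infty)=P_{es}(M^\infty)=1$, say that $P$ is EAMS$(P_{es})$ if $$\frac1n\sum_{i=1}^n P[\eta_i\varphi\in A]\to P_{es}(A)\quad(n\to\infty)\quad\text{for all }A\in\mathcal{M}^\infty,$$ and that $P$ is TAMS$(P_{ts})$ if $$\frac1x\int_0^x P[\theta_y\varphi\in A]\,dy\to P_{ts}(A)\quad(x\to\infty)\quad\text{for all }A\in\mathcal{M}.$$ **Theorem 4.1.** Let $P$ be a point process distribution with $P(M^\infty)=1$, let $P_{es}$ be an ES and $P_{ts}$ a TS point process distribution. Then $$P\text{ is EAMS}(P_{es})\iff P=P_{es}\text{ on }\mathcal{I},\qquad P\text{ is TAMS}(P_{ts})\iff P=P_{ts}\text{ on }\mathcal{I}.$$ -/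

import Mathlib

open MeasureTheory Filter Topology
open scoped ENNReal

namespace PointProcess

/-- The set `E` of all measures `φ` on the Borel sets of `ℝ` with values in `{0, 1, 2, …, ∞}` that
are finite on bounded Borel sets. -/
structure E where
  /-- the underlying Borel measure on the line -/
  toMeasure : Measure ℝ
  integer_valued : ∀ B : Set ℝ, MeasurableSet B → ∃ k : ℕ∞, toMeasure B = (k : ℝ≥0∞)
  bounded_lt_top : ∀ B : Set ℝ, MeasurableSet B → Bornology.IsBounded B → toMeasure B < ∞

/-- The `σ`-field on `E` generated by the sets `{φ | φ(B) = k}`, `B` Borel and `k` an integer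
(negative integers would only contribute the empty set). -/
instance instMeasurableSpaceE : MeasurableSpace E :=
  MeasurableSpace.generateFrom
    {S : Set E | ∃ (B : Set ℝ) (k : ℕ), MeasurableSet B ∧
      S = {φ : E | φ.toMeasure B = (k : ℝ≥0∞)}}

/-- `M`: the nonzero elements of `E` without multiple points. -/
def M : Set E :=
  {φ | 0 < φ.toMeasure Set.univ ∧ ∀ y : ℝ, φ.toMeasure {y} ≤ 1}

/-- `M^∞`: the elements of `M` with infinitely many points in both half-lines. -/
def Minf : Set E :=
  {φ | φ ∈ M ∧ φ.toMeasure (Set.Iic 0) = ∞ ∧ φ.toMeasure (Set.Ioi 0) = ∞}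

/-- The trace `σ`-field `M ∩ 𝓔` on `M`, as a family of subsets of `E`. -/
def calM : Set (Set E) :=
  {A | ∃ B : Set E, MeasurableSet B ∧ A = M ∩ B}

/-- The trace `σ`-field `M^∞ ∩ 𝓜` on `M^∞`, as a family of subsets of `E`. -/
def calMinf : Set (Set E) :=
  {A | ∃ B ∈ calM, A = Minf ∩ B}

/-- The time shift `θ_y φ = φ(y + ·)`: the image of `φ` under `t ↦ t - y`. -/
noncomputable def theta (y : ℝ) (φ : E) : E where
  toMeasure := φ.toMeasure.map (fun t : ℝ => t - y)
  integer_valued := by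
    intro B hB
    have hf : Measurable (fun t : ℝ => t - y) := measurable_id.sub_const y
    rw [Measure.map_apply hf hB]
    exact φ.integer_valued _ (hf hB)
  bounded_lt_top := by
    intro B hB hb
    have hf : Measurable (fun t : ℝ => t - y) := measurable_id.sub_const y
    rw [Measure.map_apply hf hB]
    refine φ.bounded_lt_top _ (hf hB) ?_
    obtain ⟨C, hC⟩ := hb.exists_norm_le
    refine (Metric.isBounded_closedBall (x := y) (r := C)).subset ?_
    intro t ht
    have h := hC (t - y) ht
    simpa [Metric.mem_closedBall, Real.dist_eq] using h

/-- The points of `φ`, numbered `⋯ < T₋₁ < T₀ ≤ 0 < T₁ < T₂ < ⋯`.  For `n ≥ 1`, `Tₙ` is the least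
`t > 0` with at least `n` points in `(0, t]`; for `n ≤ 0`, `Tₙ` is the largest `t ≤ 0` with at
least `1 - n` points in `[t, 0]`.  If there is no such point the value is `+∞`, respectively
`-∞`. -/
noncomputable def T (n : ℤ) (φ : E) : EReal :=
  if 0 < n then
    sInf ((fun t : ℝ => (t : EReal)) ''
      {t : ℝ | 0 < t ∧ (n.toNat : ℝ≥0∞) ≤ φ.toMeasure (Set.Ioc 0 t)})
  else
    sSup ((fun t : ℝ => (t : EReal)) ''
      {t : ℝ | t ≤ 0 ∧ ((1 - n).toNat : ℝ≥0∞) ≤ φ.toMeasure (Set.Icc t 0)})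

/-- `F_n`: the elements of `M` for which `T_n` is finite. -/
def F (n : ℤ) : Set E :=
  {φ | φ ∈ M ∧ T n φ ≠ ⊥ ∧ T n φ ≠ ⊤}

/-- The event shift `η_n φ = φ(T_n(φ) + ·)`; it is only used for `φ ∈ F_n`. -/
noncomputable def eta (n : ℤ) (φ : E) : E :=
  theta (T n φ).toReal φ

/-- `η_n⁻¹ A = [η_n φ ∈ A]`, where `η_n` has the domain `F_n`. -/
def etaPreimage (n : ℤ) (A : Set E) : Set E :=
  {φ | φ ∈ F n ∧ eta n φ ∈ A}

/-- The invariant `σ`-field `𝓘 = {A ∈ 𝓜^∞ | η₁⁻¹ A = A}`, as a family of subsets of `E`. -/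
def calI : Set (Set E) :=
  {A | A ∈ calMinf ∧ etaPreimage 1 A = A}

/-- Two measures agree on the invariant `σ`-field. -/
def AgreeOnInvariant (P Q : Measure E) : Prop :=
  ∀ A ∈ calI, P A = Q A

/-- A point process distribution: a probability measure that is concentrated on `M`. -/
structure IsDistribution (P : Measure E) : Prop where
  isProbabilityMeasure : IsProbabilityMeasure P
  simple : P M = 1

/-- Time-stationary (TS) point process distributions. -/
structure IsTS (P : Measure E) : Prop where
  isDistribution : IsDistribution P
  invariant : ∀ y : ℝ, ∀ A ∈ calM, P (theta y ⁻¹' A) = P A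

/-- Event-stationary (ES) point process distributions. -/
structure IsES (P : Measure E) : Prop where
  isDistribution : IsDistribution P
  infinite : P Minf = 1
  invariant : ∀ A ∈ calMinf, P (etaPreimage 1 A) = P A

/-- `P` is TAMS(`Q`): time-asymptotically mean stationary with limit distribution `Q`. -/
structure IsTAMS (P Q : Measure E) : Prop where
  isDistribution : IsDistribution Q
  tendsto : ∀ A ∈ calM,
    Tendsto (fun x : ℝ => (1 / x) * ∫ y in (0 : ℝ)..x, P.real (theta y ⁻¹' A)) atTop
      (𝓝 (Q.real A))

/-- `P` is EAMS(`Q`): event-asymptotically mean stationary with limit distribution `Q`, a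
probability distribution on `M^∞`. -/
structure IsEAMS (P Q : Measure E) : Prop where
  infinite : P Minf = 1
  isDistribution : IsDistribution Q
  limit_infinite : Q Minf = 1
  tendsto : ∀ A ∈ calMinf,
    Tendsto (fun n : ℕ => (1 / (n : ℝ)) * ∑ i ∈ Finset.Icc 1 n, P.real (etaPreimage (i : ℤ) A))
      atTop (𝓝 (Q.real A))

end PointProcess

/-!
On the invariant `σ`-field the averages in question do not depend on `n` or `x`, which gives both
implications from asymptotic mean stationarity to agreement on `𝓘`. For time averages this uses
that a set `A ∈ 𝓘` is invariant under all time shifts (`theta_mem_iff_of_mem_calI`): for `y ≥ 0`,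
the point pattern `η₁ (θ_y φ)` is `η_n φ` for some `n ≥ 1`, and on `M^∞` the map `η_n` is the
`n`-th iterate of `η₁`.

Conversely, let `Q` be the stationary distribution. By the mean ergodic theorem in `L²(Q)`, the
averages of an indicator function along the shifts converge in `Q`-measure
(`exists_tendstoInMeasure_birkhoffAverage`), hence `Q`-almost surely along a further subsequence of
any given subsequence. The set where such a subsequence converges and the value of its limit are
shift-invariant, since shifting the starting point changes an average over a long stretch by little.
As `P` and `Q` agree on invariant sets, the subsequence also converges `P`-almost surely, and the
limit has the same integral under `P` and `Q`; dominated convergence identifies the limit of the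
`P`-expectations (`tendsto_integral_of_agree_on_invariant`). Thus no pointwise ergodic theorem is
needed. For time averages the theorem is applied to the unit shift `θ₁` and the function
`φ ↦ ∫₀¹ 1_A(θ_y φ) dy`, whose Birkhoff averages are the time averages up to integer times; the
limit is nevertheless invariant under the whole flow. Measurability of `(y, φ) ↦ θ_y φ`
makes Fubini's theorem available.
-/

namespace PointProcess

/-! ### Ergodic averages and invariant sets -/

/-- Birkhoff averages of a square-integrable function converge in measure. This is von Neumann's
mean ergodic theorem for the Koopman operator on `L²(Q)`. -/
theorem exists_tendstoInMeasure_birkhoffAverage {X : Type*} [MeasurableSpace X] {Q : Measure X}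
    {τ : X → X} (hτ : MeasurePreserving τ Q Q) {f : X → ℝ} (hf : MemLp f 2 Q) :
    ∃ h : X → ℝ, TendstoInMeasure Q (birkhoffAverage ℝ τ f) atTop h := by
  let U : Lp ℝ 2 Q →L[ℝ] Lp ℝ 2 Q :=
    (Lp.compMeasurePreservingₗᵢ ℝ τ hτ).toContinuousLinearMap
  have hU : ‖U‖ ≤ 1 := LinearIsometry.norm_toContinuousLinearMap_le _
  have hiter : ∀ k : ℕ, (U^[k] (hf.toLp f) : X → ℝ) =ᵐ[Q] f ∘ τ^[k] := by
    intro k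
    have h1 : U^[k] (hf.toLp f) =
        Lp.compMeasurePreserving τ^[k] (hτ.iterate k) (hf.toLp f) := by
      rw [← Lp.compMeasurePreserving_iterate]
      rfl
    rw [h1, Lp.toLp_compMeasurePreserving]
    exact MemLp.coeFn_toLp _
  have hsum : ∀ n : ℕ, ((birkhoffSum U _root_.id n (hf.toLp f) : Lp ℝ 2 Q) : X → ℝ) =ᵐ[Q]
      birkhoffSum τ f n := by
    intro n
    induction n with
    | zero =>
      rw [birkhoffSum_zero, birkhoffSum_zero']
      exact Lp.coeFn_zero _ _ _
    | succ n ih =>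
      rw [birkhoffSum_succ]
      filter_upwards [ih, hiter n, Lp.coeFn_add (birkhoffSum U _root_.id n (hf.toLp f))
        (U^[n] (hf.toLp f))] with x h1 h2 h3
      rw [birkhoffSum_succ, ← h1]
      simp only [id, Pi.add_apply] at h3 ⊢
      rw [h3, h2, Function.comp_apply]
  have havg : ∀ n : ℕ, ((birkhoffAverage ℝ U _root_.id n (hf.toLp f) : Lp ℝ 2 Q) : X → ℝ) =ᵐ[Q]
      birkhoffAverage ℝ τ f n := by
    intro n
    filter_upwards [hsum n, Lp.coeFn_smul ((n : ℝ)⁻¹) (birkhoffSum U _root_.id n (hf.toLp f))]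
      with x h1 h2
    rw [birkhoffAverage, h2, Pi.smul_apply, h1, birkhoffAverage]
  exact ⟨_, (tendstoInMeasure_of_tendsto_Lp
    (U.tendsto_birkhoffAverage_orthogonalProjection hU (hf.toLp f))).congr_left havg⟩

/-- Transfer of limits of integrals between measures that agree on invariant sets. The relation `R`
encodes the dynamics: a set is invariant if it does not separate `R`-related points, and the
functions `g n` are asymptotically invariant. -/
theorem tendsto_integral_of_agree_on_invariant {X : Type*} [MeasurableSpace X] {P Q : Measure X}
    [IsProbabilityMeasure P] [IsProbabilityMeasure Q] {g : ℕ → X → ℝ} {h : X → ℝ} {C c : ℝ}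
    {R : X → X → Prop} (hg : ∀ n, Measurable (g n)) (hC : ∀ n x, |g n x| ≤ C)
    (hconv : TendstoInMeasure Q g atTop h)
    (hR : ∀ x y, R x y → Tendsto (fun n => g n x - g n y) atTop (𝓝 0))
    (hPQ : ∀ S : Set X, MeasurableSet S → (∀ x y, R x y → (x ∈ S ↔ y ∈ S)) → P S = Q S)
    (hc : ∀ᶠ n in atTop, ∫ x, g n x ∂Q = c) :
    Tendsto (fun n => ∫ x, g n x ∂P) atTop (𝓝 c) := by
  -- Convergence in measure gives almost sure convergence only along subsequences; this is enough
  -- because the limit of the integrals does not depend on the subsequence.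
  refine tendsto_of_subseq_tendsto fun ms hms => ?_
  obtain ⟨ns, hns, hae⟩ := (hconv.comp hms).exists_seq_tendsto_ae
  have hk : Tendsto (fun k => ms (ns k)) atTop atTop := hms.comp hns.tendsto_atTop
  refine ⟨ns, ?_⟩
  let u : ℕ → X → ℝ := fun k => g (ms (ns k))
  have hu : ∀ k, Measurable (u k) := fun k => hg _
  let convSet : Set X := {x | ∃ l, Tendsto (fun k => u k x) atTop (𝓝 l)}
  let limit : X → ℝ := fun x => limUnder atTop (fun k => u k x)
  have hconv_meas : MeasurableSet convSet := measurableSet_exists_tendsto hu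
  have hlim_meas : Measurable limit :=
    (StronglyMeasurable.limUnder fun k => (hu k).stronglyMeasurable).measurable
  have hR' : ∀ x y, R x y → ∀ l,
      (Tendsto (fun k => u k x) atTop (𝓝 l) ↔ Tendsto (fun k => u k y) atTop (𝓝 l)) := by
    intro x y hxy l
    have h0 : Tendsto (fun k => u k x - u k y) atTop (𝓝 0) := (hR x y hxy).comp hk
    constructor
    · intro hl
      simpa using hl.sub h0
    · intro hl
      simpa using hl.add h0
  -- Off `convSet` the junk value of `limUnder` is one and the same constant.
  have hlim_inv : ∀ x y, R x y → limit x = limit y := by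
    intro x y hxy
    by_cases hx : x ∈ convSet
    · obtain ⟨l, hl⟩ := hx
      exact hl.limUnder_eq.trans ((hR' x y hxy l).1 hl).limUnder_eq.symm
    · have hy : y ∉ convSet := fun ⟨l, hl⟩ => hx ⟨l, (hR' x y hxy l).2 hl⟩
      exact (limUnder_of_not_tendsto hx).trans (limUnder_of_not_tendsto hy).symm
  have hconvQ : ∀ᵐ x ∂Q, x ∈ convSet := hae.mono fun x hx => ⟨_, hx⟩
  have hconvP : ∀ᵐ x ∂P, x ∈ convSet := by
    have h0 : P convSetᶜ = Q convSetᶜ := hPQ _ hconv_meas.compl fun x y hxy =>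
      not_congr (exists_congr fun l => hR' x y hxy l)
    exact mem_ae_iff.2 (h0.trans (mem_ae_iff.1 hconvQ))
  have hint : ∫ x, limit x ∂P = ∫ x, limit x ∂Q := by
    have hmap : P.map limit = Q.map limit := by
      ext B hB
      rw [Measure.map_apply hlim_meas hB, Measure.map_apply hlim_meas hB]
      refine hPQ _ (hlim_meas hB) fun x y hxy => ?_
      simp only [Set.mem_preimage, hlim_inv x y hxy]
    rw [← integral_map (f := fun t : ℝ => t) hlim_meas.aemeasurable (by fun_prop), hmap,
      integral_map (f := fun t : ℝ => t) hlim_meas.aemeasurable (by fun_prop)]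
  have hdct : ∀ μ : Measure X, IsProbabilityMeasure μ → (∀ᵐ x ∂μ, x ∈ convSet) →
      Tendsto (fun k => ∫ x, u k x ∂μ) atTop (𝓝 (∫ x, limit x ∂μ)) := by
    intro μ _ hμ
    refine tendsto_integral_of_dominated_convergence (fun _ => C)
      (fun k => (hu k).aestronglyMeasurable) (integrable_const C)
      (fun k => ae_of_all _ fun x => hC _ x) ?_
    filter_upwards [hμ] with x hx
    exact tendsto_nhds_limUnder hx
  have hQc : ∫ x, limit x ∂Q = c :=
    tendsto_nhds_unique (hdct Q inferInstance hconvQ)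
      (tendsto_const_nhds.congr' ((hk.eventually hc).mono fun k hk' => hk'.symm))
  rw [← hQc, ← hint]
  exact hdct P inferInstance hconvP

theorem measurable_birkhoffAverage {X : Type*} [MeasurableSpace X] {τ : X → X} {f : X → ℝ}
    (hτ : Measurable τ) (hf : Measurable f) (n : ℕ) : Measurable (birkhoffAverage ℝ τ f n) := by
  have hsum : Measurable fun x => ∑ k ∈ Finset.range n, f (τ^[k] x) :=
    Finset.measurable_fun_sum _ fun k _ => hf.comp (hτ.iterate k)
  exact hsum.const_smul (n : ℝ)⁻¹

theorem abs_birkhoffAverage_le {X : Type*} {τ : X → X} {f : X → ℝ} (hf : ∀ x, |f x| ≤ 1)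
    (n : ℕ) (x : X) : |birkhoffAverage ℝ τ f n x| ≤ 1 := by
  have hsum : |birkhoffSum τ f n x| ≤ n := by
    calc |birkhoffSum τ f n x| ≤ ∑ k ∈ Finset.range n, |f (τ^[k] x)| :=
          Finset.abs_sum_le_sum_abs _ _
      _ ≤ ∑ _k ∈ Finset.range n, (1 : ℝ) := Finset.sum_le_sum fun k _ => hf _
      _ = n := by simp
  rw [birkhoffAverage, smul_eq_mul, abs_mul, abs_inv, Nat.abs_cast]
  exact inv_mul_le_one_of_le₀ hsum n.cast_nonneg

/-- Averages of a bounded function over `[0, x]` converge if they do so along integer `x`. -/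
theorem tendsto_average_of_tendsto_natCast {w : ℝ → ℝ} {c : ℝ} (hw : Measurable w)
    (hw1 : ∀ y, |w y| ≤ 1)
    (h : Tendsto (fun n : ℕ => (1 / (n : ℝ)) * ∫ y in (0 : ℝ)..n, w y) atTop (𝓝 c)) :
    Tendsto (fun x : ℝ => (1 / x) * ∫ y in (0 : ℝ)..x, w y) atTop (𝓝 c) := by
  have hint : ∀ a b : ℝ, IntervalIntegrable w volume a b := fun a b =>
    (intervalIntegrable_const (c := (1 : ℝ))).mono_fun hw.aestronglyMeasurable
      (ae_of_all _ fun y => by simpa using hw1 y)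
  have hmain : Tendsto (fun x : ℝ => ((⌊x⌋₊ : ℝ) / x) *
      ((1 / (⌊x⌋₊ : ℝ)) * ∫ y in (0 : ℝ)..⌊x⌋₊, w y)) atTop (𝓝 c) := by
    simpa using (tendsto_nat_floor_div_atTop (R := ℝ)).mul
      (h.comp (tendsto_nat_floor_atTop (α := ℝ)))
  have hrest : Tendsto (fun x : ℝ => (1 / x) * ∫ y in (⌊x⌋₊ : ℝ)..x, w y) atTop (𝓝 0) := by
    refine squeeze_zero_norm' ?_ tendsto_inv_atTop_zero
    filter_upwards [eventually_gt_atTop 0] with x hx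
    have h1 : ‖∫ y in (⌊x⌋₊ : ℝ)..x, w y‖ ≤ 1 := by
      refine (intervalIntegral.norm_integral_le_of_norm_le_const (C := 1) fun y _ => hw1 y).trans ?_
      rw [one_mul, abs_of_nonneg (sub_nonneg.2 (Nat.floor_le hx.le))]
      linarith [Nat.lt_floor_add_one x]
    rw [norm_mul, one_div, norm_inv, Real.norm_of_nonneg hx.le]
    exact mul_le_of_le_one_right (inv_nonneg.2 hx.le) h1
  refine (by simpa using hmain.add hrest : Tendsto _ _ (𝓝 c)).congr' ?_
  filter_upwards [eventually_ge_atTop 1] with x hx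
  have hfloor : (⌊x⌋₊ : ℝ) ≠ 0 := by
    have := Nat.floor_pos.2 hx
    positivity
  rw [← intervalIntegral.integral_add_adjacent_intervals (hint 0 ⌊x⌋₊) (hint _ x)]
  field_simp

theorem abs_indicator_one_le {X : Type*} (A : Set X) (x : X) :
    |A.indicator (1 : X → ℝ) x| ≤ 1 := by
  by_cases h : x ∈ A <;> simp [h]

/-! ### Measurability on the space of counting measures -/

theorem measurable_toMeasure_apply {B : Set ℝ} (hB : MeasurableSet B) :
    Measurable fun φ : E => φ.toMeasure B := by
  have hnat : ∀ k : ℕ, MeasurableSet {φ : E | φ.toMeasure B = (k : ℝ≥0∞)} := fun k =>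
    MeasurableSpace.measurableSet_generateFrom ⟨B, k, hB, rfl⟩
  -- The generators omit the value `∞`, which is the complement of the finite values.
  have hall : ∀ k : ℕ∞, MeasurableSet {φ : E | φ.toMeasure B = (k : ℝ≥0∞)} := by
    intro k
    induction k using ENat.recTopCoe with
    | coe k => simpa using hnat k
    | top =>
      have : {φ : E | φ.toMeasure B = ((⊤ : ℕ∞) : ℝ≥0∞)} =
          (⋃ k : ℕ, {φ : E | φ.toMeasure B = (k : ℝ≥0∞)})ᶜ := by
        ext φ
        simp only [Set.mem_ofPred_eq, Set.mem_compl_iff, Set.mem_iUnion, ENat.toENNReal_top]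
        constructor
        · rintro h ⟨k, hk⟩
          simp [h] at hk
        · intro h
          obtain ⟨k, hk⟩ := φ.integer_valued B hB
          induction k using ENat.recTopCoe with
          | coe k => exact absurd ⟨k, by simpa using hk⟩ h
          | top => simpa using hk
      rw [this]
      exact (MeasurableSet.iUnion hnat).compl
  intro S _
  have : (fun φ : E => φ.toMeasure B) ⁻¹' S =
      ⋃ (k : ℕ∞) (_ : (k : ℝ≥0∞) ∈ S), {φ : E | φ.toMeasure B = (k : ℝ≥0∞)} := by
    ext φ
    simp only [Set.mem_preimage, Set.mem_iUnion, Set.mem_ofPred_eq, exists_prop]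
    constructor
    · intro h
      obtain ⟨k, hk⟩ := φ.integer_valued B hB
      exact ⟨k, hk ▸ h, hk⟩
    · rintro ⟨k, hk, h⟩
      rwa [h]
  rw [this]
  exact MeasurableSet.iUnion fun k => MeasurableSet.iUnion fun _ => hall k

theorem one_le_of_toMeasure_ne_zero (φ : E) {B : Set ℝ} (hB : MeasurableSet B)
    (h : φ.toMeasure B ≠ 0) : 1 ≤ φ.toMeasure B := by
  obtain ⟨k, hk⟩ := φ.integer_valued B hB
  rw [hk] at h ⊢
  have : k ≠ 0 := by rintro rfl; simp at h
  exact_mod_cast Order.one_le_iff_ne_zero.2 this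

theorem toMeasure_le_one_of_lt_two (φ : E) {B : Set ℝ} (hB : MeasurableSet B)
    (h : φ.toMeasure B < 2) : φ.toMeasure B ≤ 1 := by
  obtain ⟨k, hk⟩ := φ.integer_valued B hB
  rw [hk] at h ⊢
  have h' : k < 2 := by exact_mod_cast h
  have : k ≤ 1 := ENat.lt_add_one_iff (by simp) |>.1 (by simpa [one_add_one_eq_two] using h')
  exact_mod_cast this

theorem exists_closedBall_toMeasure_le_one (φ : E) {y : ℝ} (hy : φ.toMeasure {y} ≤ 1) :
    ∃ ε > 0, φ.toMeasure (Metric.closedBall y ε) ≤ 1 := by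
  have hlim : Tendsto (fun ε => φ.toMeasure (Metric.cthickening ε {y})) (𝓝 0)
      (𝓝 (φ.toMeasure {y})) :=
    tendsto_measure_cthickening_of_isClosed
      ⟨1, one_pos, by
        rw [Metric.cthickening_singleton y zero_le_one]
        exact (φ.bounded_lt_top _ measurableSet_closedBall Metric.isBounded_closedBall).ne⟩
      isClosed_singleton
  have h2 : ∀ᶠ ε in 𝓝[>] (0 : ℝ), φ.toMeasure (Metric.cthickening ε {y}) < 2 :=
    (hlim.mono_left nhdsWithin_le_nhds).eventually_lt_const
      (hy.trans_lt (by norm_num))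
  obtain ⟨ε, hε, hpos⟩ := (h2.and self_mem_nhdsWithin).exists
  refine ⟨ε, hpos, toMeasure_le_one_of_lt_two φ Metric.isClosed_closedBall.measurableSet ?_⟩
  rwa [Metric.cthickening_singleton _ (le_of_lt hpos)] at hε

/-- The absence of multiple points, expressed by countably many conditions: on each bounded window,
a Lebesgue number argument yields a radius at which all balls contain at most one point. -/
theorem toMeasure_singleton_le_one_iff (φ : E) :
    (∀ y : ℝ, φ.toMeasure {y} ≤ 1) ↔
      ∀ N : ℕ, ∃ n : ℕ, ∀ q : ℚ, |(q : ℝ)| ≤ N →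
        φ.toMeasure (Metric.closedBall (q : ℝ) (1 / (n + 1))) ≤ 1 := by
  constructor
  · intro h N
    choose ε hε hφ using fun y => exists_closedBall_toMeasure_le_one φ (h y)
    obtain ⟨δ, hδ, hleb⟩ := lebesgue_number_lemma_of_metric
      (isCompact_Icc (a := -(N : ℝ)) (b := N)) (c := fun y : ℝ => Metric.ball y (ε y))
      (fun _ => Metric.isOpen_ball)
      (fun y _ => Set.mem_iUnion.2 ⟨y, Metric.mem_ball_self (hε y)⟩)
    obtain ⟨n, hn⟩ := exists_nat_one_div_lt hδ
    refine ⟨n, fun q hq => ?_⟩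
    obtain ⟨y, hy⟩ := hleb q (abs_le.1 hq)
    exact (measure_mono ((Metric.closedBall_subset_ball hn).trans
      (hy.trans Metric.ball_subset_closedBall))).trans (hφ y)
  · intro h y
    obtain ⟨N, hN⟩ := exists_nat_ge (|y| + 1)
    obtain ⟨n, hn⟩ := h N
    have hpos : (0 : ℝ) < 1 / (n + 1) := Nat.one_div_pos_of_nat
    have hle : (1 : ℝ) / (n + 1) ≤ 1 := by
      rw [div_le_one (by positivity)]; linarith [Nat.cast_nonneg (α := ℝ) n]
    obtain ⟨q, hq1, hq2⟩ := exists_rat_btwn (lt_add_of_pos_right y hpos)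
    refine (measure_mono (Set.singleton_subset_iff.2 ?_)).trans (hn q ?_)
    · rw [Metric.mem_closedBall, Real.dist_eq, abs_le]
      constructor <;> linarith
    · refine le_trans ?_ hN
      rw [abs_le]
      constructor <;> linarith [neg_abs_le y, le_abs_self y]

theorem measurableSet_M : MeasurableSet M := by
  have h : M = {φ : E | 0 < φ.toMeasure Set.univ} ∩ ⋂ N : ℕ, ⋃ n : ℕ, ⋂ q : ℚ,
      ⋂ _ : |(q : ℝ)| ≤ N, {φ : E | φ.toMeasure (Metric.closedBall (q : ℝ) (1 / (n + 1))) ≤ 1} := by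
    ext φ
    simp only [M, Set.mem_ofPred_eq, Set.mem_inter_iff, Set.mem_iInter, Set.mem_iUnion,
      toMeasure_singleton_le_one_iff]
  rw [h]
  refine (measurableSet_lt measurable_const (measurable_toMeasure_apply .univ)).inter ?_
  exact .iInter fun N => .iUnion fun n => .iInter fun q => .iInter fun _ =>
    measurableSet_le (measurable_toMeasure_apply Metric.isClosed_closedBall.measurableSet)
      measurable_const

theorem measurableSet_Minf : MeasurableSet Minf :=
  measurableSet_M.inter
    ((measurable_toMeasure_apply measurableSet_Iic (measurableSet_singleton ∞)).inter
      (measurable_toMeasure_apply measurableSet_Ioi (measurableSet_singleton ∞)))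

theorem measurableSet_of_mem_calM {A : Set E} (hA : A ∈ calM) : MeasurableSet A := by
  obtain ⟨B, hB, rfl⟩ := hA
  exact measurableSet_M.inter hB

theorem Minf_subset_M : Minf ⊆ M := fun _ h => h.1

theorem mem_calMinf_iff {A : Set E} : A ∈ calMinf ↔ MeasurableSet A ∧ A ⊆ Minf := by
  constructor
  · rintro ⟨B, hB, rfl⟩
    exact ⟨measurableSet_Minf.inter (measurableSet_of_mem_calM hB), Set.inter_subset_left⟩
  · rintro ⟨hA, hsub⟩
    refine ⟨M ∩ A, ⟨A, hA, rfl⟩, ?_⟩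
    rw [Set.inter_eq_right.2 (hsub.trans Minf_subset_M), Set.inter_eq_right.2 hsub]

theorem mem_calM_iff {A : Set E} : A ∈ calM ↔ MeasurableSet A ∧ A ⊆ M := by
  constructor
  · intro hA
    refine ⟨measurableSet_of_mem_calM hA, ?_⟩
    obtain ⟨B, -, rfl⟩ := hA
    exact Set.inter_subset_left
  · rintro ⟨hA, hsub⟩
    exact ⟨A, hA, (Set.inter_eq_right.2 hsub).symm⟩

theorem ae_mem_Minf {P : Measure E} [IsProbabilityMeasure P] (hP : P Minf = 1) :
    ∀ᵐ φ ∂P, φ ∈ Minf :=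
  mem_ae_iff.2 ((prob_compl_eq_zero_iff measurableSet_Minf).2 hP)

theorem measure_inter_Minf {P : Measure E} [IsProbabilityMeasure P] (hP : P Minf = 1)
    (S : Set E) : P (S ∩ Minf) = P S :=
  measure_inter_conull ((prob_compl_eq_zero_iff measurableSet_Minf).2 hP)

/-! ### The time shift -/

theorem theta_apply (y : ℝ) (φ : E) {B : Set ℝ} (hB : MeasurableSet B) :
    (theta y φ).toMeasure B = φ.toMeasure ((fun t => t - y) ⁻¹' B) :=
  Measure.map_apply (measurable_id.sub_const y) hB

theorem E.ext_toMeasure {φ ψ : E} (h : φ.toMeasure = ψ.toMeasure) : φ = ψ := by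
  cases φ; cases ψ; congr

theorem theta_theta (x y : ℝ) (φ : E) : theta x (theta y φ) = theta (y + x) φ := by
  refine E.ext_toMeasure (Measure.ext fun B hB => ?_)
  have hB' : MeasurableSet ((fun t : ℝ => t - x) ⁻¹' B) := (measurable_id.sub_const x) hB
  rw [theta_apply x _ hB, theta_apply y _ hB', theta_apply _ _ hB, ← Set.preimage_comp]
  congr 2
  ext t
  simp [sub_sub]

theorem theta_zero (φ : E) : theta 0 φ = φ := by
  refine E.ext_toMeasure (Measure.ext fun B hB => ?_)
  rw [theta_apply _ _ hB]
  simp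

/-- The flow is jointly measurable. On a bounded window, `φ` is a kernel with finite values, for
which the measures of the sections of a measurable set depend measurably on the parameter. -/
theorem measurable_theta_uncurry : Measurable fun p : ℝ × E => theta p.1 p.2 := by
  refine measurable_generateFrom ?_
  rintro _ ⟨B, k, hB, rfl⟩
  let κ : ℕ → ProbabilityTheory.Kernel (ℝ × E) ℝ := fun N =>
    ⟨fun p => p.2.toMeasure.restrict (Set.Icc (-(N : ℝ)) N),
      Measure.measurable_of_measurable_coe _ fun B hB => by
        simp_rw [Measure.restrict_apply hB]
        exact (measurable_toMeasure_apply (hB.inter measurableSet_Icc)).comp measurable_snd⟩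
  have hκ : ∀ N p, IsFiniteMeasure (κ N p) := fun N p =>
    ⟨by simpa [κ] using
      p.2.bounded_lt_top _ measurableSet_Icc (Metric.isBounded_Icc (-(N : ℝ)) N)⟩
  let S : Set ((ℝ × E) × ℝ) := {q | q.2 - q.1.1 ∈ B}
  have hS : MeasurableSet S :=
    (show Measurable fun q : (ℝ × E) × ℝ => q.2 - q.1.1 by fun_prop) hB
  have hmeas : Measurable fun p : ℝ × E => ⨆ N, κ N p (Prod.mk p ⁻¹' S) :=
    Measurable.iSup fun N =>
      ProbabilityTheory.Kernel.measurable_kernel_prodMk_left_of_finite hS (hκ N)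
  have heq : ∀ p : ℝ × E, (theta p.1 p.2).toMeasure B = ⨆ N, κ N p (Prod.mk p ⁻¹' S) := by
    intro p
    have hSp : MeasurableSet (Prod.mk p ⁻¹' S) := measurable_prodMk_left hS
    have hmono : Monotone fun N : ℕ => Prod.mk p ⁻¹' S ∩ Set.Icc (-(N : ℝ)) N := by
      intro N N' h
      have h' : (N : ℝ) ≤ N' := by exact_mod_cast h
      exact Set.inter_subset_inter_right _ (Set.Icc_subset_Icc (neg_le_neg h') h')
    have hcover : Prod.mk p ⁻¹' S = ⋃ N : ℕ, Prod.mk p ⁻¹' S ∩ Set.Icc (-(N : ℝ)) N := by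
      rw [← Set.inter_iUnion]
      refine (Set.inter_eq_left.2 fun t _ => ?_).symm
      obtain ⟨N, hN⟩ := exists_nat_ge |t|
      exact Set.mem_iUnion.2 ⟨N, abs_le.1 hN⟩
    rw [theta_apply _ _ hB]
    change p.2.toMeasure (Prod.mk p ⁻¹' S) = ⨆ N : ℕ, p.2.toMeasure.restrict _ (Prod.mk p ⁻¹' S)
    simp_rw [Measure.restrict_apply hSp]
    rw [← hmono.measure_iUnion, ← hcover]
  exact (hmeas (measurableSet_singleton (k : ℝ≥0∞))).congr
    (by ext p; simp [heq p])

theorem measurable_theta (y : ℝ) : Measurable (theta y) :=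
  measurable_theta_uncurry.comp measurable_prodMk_left

theorem theta_mem_M_iff (y : ℝ) (φ : E) : theta y φ ∈ M ↔ φ ∈ M := by
  have key : ∀ (y : ℝ) (φ : E), φ ∈ M → theta y φ ∈ M := by
    rintro y φ ⟨h0, h1⟩
    refine ⟨by rwa [theta_apply _ _ .univ, Set.preimage_univ], fun t => ?_⟩
    rw [theta_apply _ _ (measurableSet_singleton t)]
    convert h1 (t + y) using 2
    ext s
    simp [sub_eq_iff_eq_add]
  refine ⟨fun h => ?_, key y φ⟩
  simpa [theta_theta, theta_zero] using key (-y) _ h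

theorem theta_mem_Minf_iff (y : ℝ) (φ : E) : theta y φ ∈ Minf ↔ φ ∈ Minf := by
  have key : ∀ (y : ℝ) (φ : E), φ ∈ Minf → theta y φ ∈ Minf := by
    rintro y φ ⟨hM, hneg, hpos⟩
    have hfin : φ.toMeasure (Set.uIcc 0 y) ≠ ∞ :=
      (φ.bounded_lt_top _ measurableSet_uIcc isCompact_uIcc.isBounded).ne
    refine ⟨(theta_mem_M_iff y φ).2 hM, ?_, ?_⟩
    · rw [theta_apply _ _ measurableSet_Iic]
      have hsub : Set.Iic (0 : ℝ) ⊆ (fun t : ℝ => t - y) ⁻¹' Set.Iic 0 ∪ Set.uIcc 0 y := by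
        intro t ht
        simp only [Set.mem_union, Set.mem_preimage, Set.mem_Iic, Set.mem_uIcc] at ht ⊢
        rcases le_total t y with h | h
        · left; linarith
        · right; right; exact ⟨h, ht⟩
      have := (measure_mono hsub).trans (measure_union_le (μ := φ.toMeasure) _ _)
      rw [hneg, top_le_iff, ENNReal.add_eq_top] at this
      exact this.resolve_right hfin
    · rw [theta_apply _ _ measurableSet_Ioi]
      have hsub : Set.Ioi (0 : ℝ) ⊆ (fun t : ℝ => t - y) ⁻¹' Set.Ioi 0 ∪ Set.uIcc 0 y := by
        intro t ht
        simp only [Set.mem_union, Set.mem_preimage, Set.mem_Ioi, Set.mem_uIcc] at ht ⊢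
        rcases le_or_gt t y with h | h
        · right; left; exact ⟨ht.le, h⟩
        · left; linarith
      have := (measure_mono hsub).trans (measure_union_le (μ := φ.toMeasure) _ _)
      rw [hpos, top_le_iff, ENNReal.add_eq_top] at this
      exact this.resolve_right hfin
  refine ⟨fun h => ?_, key y φ⟩
  simpa [theta_theta, theta_zero] using key (-y) _ h

/-! ### The event shift -/

/-- The times `t > 0` by which `φ` has at least `n` points in `(0, t]`. -/
def hitTimes (n : ℕ) (φ : E) : Set ℝ :=
  {t : ℝ | 0 < t ∧ (n : ℝ≥0∞) ≤ φ.toMeasure (Set.Ioc 0 t)}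

theorem T_natCast {n : ℕ} (hn : 0 < n) (φ : E) :
    T n φ = sInf ((fun t : ℝ => (t : EReal)) '' hitTimes n φ) := by
  rw [T, if_pos (by exact_mod_cast hn)]
  rfl

theorem bddBelow_hitTimes (n : ℕ) (φ : E) : BddBelow (hitTimes n φ) :=
  ⟨0, fun _ ht => ht.1.le⟩

theorem hitTimes_nonempty {φ : E} (hφ : φ ∈ Minf) (n : ℕ) : (hitTimes n φ).Nonempty := by
  have hmono : Monotone fun k : ℕ => Set.Ioc (0 : ℝ) k := fun k l h =>
    Set.Ioc_subset_Ioc_right (by exact_mod_cast h)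
  have hcover : (⋃ k : ℕ, Set.Ioc (0 : ℝ) k) = Set.Ioi 0 := by
    ext t
    simp only [Set.mem_iUnion, Set.mem_Ioc, Set.mem_Ioi]
    exact ⟨fun ⟨_, h, _⟩ => h, fun h => (exists_nat_ge t).imp fun _ hk => ⟨h, hk⟩⟩
  have hsup : (⨆ k : ℕ, φ.toMeasure (Set.Ioc (0 : ℝ) k)) = ∞ := by
    rw [← hmono.measure_iUnion, hcover, hφ.2.2]
  obtain ⟨k, hk⟩ := lt_iSup_iff.1 (hsup ▸ ENNReal.natCast_lt_top n :
    (n : ℝ≥0∞) < ⨆ k : ℕ, φ.toMeasure (Set.Ioc (0 : ℝ) k))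
  exact ⟨k + 1, by positivity,
    hk.le.trans (measure_mono (Set.Ioc_subset_Ioc_right (by linarith)))⟩

/-- On `M^∞`, the point `T_n` with `n ≥ 1` is finite, and the infimum defining it can be taken
in `ℝ`. -/
theorem T_natCast_eq_coe {φ : E} (hφ : φ ∈ Minf) {n : ℕ} (hn : 0 < n) :
    T n φ = ((sInf (hitTimes n φ) : ℝ) : EReal) := by
  rw [T_natCast hn]
  have hglb := isGLB_csInf (hitTimes_nonempty hφ n) (bddBelow_hitTimes n φ)
  refine IsGLB.sInf_eq ⟨?_, fun b hb => ?_⟩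
  · rintro _ ⟨t, ht, rfl⟩
    exact EReal.coe_le_coe_iff.2 (hglb.1 ht)
  · induction b with
    | bot => exact bot_le
    | top =>
      obtain ⟨t, ht⟩ := hitTimes_nonempty hφ n
      exact absurd (hb ⟨t, ht, rfl⟩) (by simp)
    | coe b =>
      exact EReal.coe_le_coe_iff.2 (hglb.2 fun t ht => EReal.coe_le_coe_iff.1 (hb ⟨t, ht, rfl⟩))

theorem toReal_T_natCast {φ : E} (hφ : φ ∈ Minf) {n : ℕ} (hn : 0 < n) :
    (T n φ).toReal = sInf (hitTimes n φ) := by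
  rw [T_natCast_eq_coe hφ hn, EReal.toReal_coe]

theorem Minf_subset_F {n : ℕ} (hn : 0 < n) : Minf ⊆ F n := fun φ hφ =>
  ⟨hφ.1, by simp [T_natCast_eq_coe hφ hn], by simp [T_natCast_eq_coe hφ hn]⟩

/-- The first positive point is attained and simple, so `(0, T₁]` has mass exactly `1`. -/
theorem toMeasure_Ioc_firstPoint {φ : E} (hφ : φ ∈ Minf) :
    φ.toMeasure (Set.Ioc 0 (T 1 φ).toReal) = 1 := by
  have hT : (T 1 φ).toReal = sInf (hitTimes 1 φ) := toReal_T_natCast hφ one_pos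
  rw [hT]
  set r := sInf (hitTimes 1 φ)
  refine le_antisymm ?_ ?_
  · have hnull : φ.toMeasure (Set.Ioo 0 r) = 0 := by
      have hsub : Set.Ioo 0 r ⊆ ⋃ (q : ℚ) (_ : 0 < (q : ℝ) ∧ (q : ℝ) < r), Set.Ioc 0 (q : ℝ) := by
        intro t ht
        obtain ⟨q, hq1, hq2⟩ := exists_rat_btwn ht.2
        simp only [Set.mem_iUnion]
        exact ⟨q, ⟨ht.1.trans hq1, hq2⟩, ht.1, hq1.le⟩
      refine measure_mono_null hsub (measure_iUnion_null fun q => measure_iUnion_null fun hq => ?_)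
      by_contra h
      have := one_le_of_toMeasure_ne_zero φ measurableSet_Ioc h
      exact absurd (csInf_le (bddBelow_hitTimes 1 φ) ⟨hq.1, by simpa using this⟩) (not_le.2 hq.2)
    calc φ.toMeasure (Set.Ioc 0 r) ≤ φ.toMeasure (Set.Ioo 0 r ∪ {r}) :=
          measure_mono fun t ht => by
            rcases ht.2.lt_or_eq with h | h
            · exact Or.inl ⟨ht.1, h⟩
            · exact Or.inr h
      _ ≤ φ.toMeasure (Set.Ioo 0 r) + φ.toMeasure {r} := measure_union_le _ _
      _ ≤ 1 := by rw [hnull, zero_add]; exact hφ.1.2 r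
  · have hlim := tendsto_measure_biInter_gt (μ := φ.toMeasure) (s := fun t => Set.Ioc 0 t) (a := r)
      (fun _ _ => measurableSet_Ioc.nullMeasurableSet)
      (fun _ _ _ h => Set.Ioc_subset_Ioc_right h)
      ⟨r + 1, by simp, (φ.bounded_lt_top _ measurableSet_Ioc (Metric.isBounded_Ioc _ _)).ne⟩
    have hInter : (⋂ t > r, Set.Ioc 0 t) = Set.Ioc 0 r := by
      ext s
      simp only [Set.mem_iInter, Set.mem_Ioc]
      refine ⟨fun h => ⟨(h (r + 1) (by simp)).1, ?_⟩, fun h t ht => ⟨h.1, h.2.trans ht.le⟩⟩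
      exact le_of_forall_gt_imp_ge_of_dense fun t ht => (h t ht).2
    rw [hInter] at hlim
    refine ge_of_tendsto hlim (eventually_nhdsWithin_of_forall fun t ht => ?_)
    obtain ⟨s, hs, hst⟩ := exists_lt_of_csInf_lt (hitTimes_nonempty hφ 1) ht
    simpa using hs.2.trans (measure_mono (Set.Ioc_subset_Ioc_right hst.le))

theorem firstPoint_pos {φ : E} (hφ : φ ∈ Minf) : 0 < (T 1 φ).toReal := by
  by_contra h
  have := toMeasure_Ioc_firstPoint hφ
  rw [Set.Ioc_eq_empty h, measure_empty] at this
  exact zero_ne_one this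

/-- If `(0, y]` contains `k` points, the `(n + k)`-th point of `φ` is the `n`-th point after `y`.
The condition `0 < n` excludes hitting times in `(0, y]`. -/
theorem hitTimes_add {φ : E} {y : ℝ} (hy : 0 ≤ y) {k n : ℕ} (hn : 0 < n)
    (hk : φ.toMeasure (Set.Ioc 0 y) = k) :
    hitTimes (n + k) φ = OrderIso.addLeft y '' hitTimes n (theta y φ) := by
  have hsplit : ∀ s, 0 ≤ s → φ.toMeasure (Set.Ioc 0 (y + s)) =
      (theta y φ).toMeasure (Set.Ioc 0 s) + k := by
    intro s hs
    rw [← Set.Ioc_union_Ioc_eq_Ioc hy (le_add_of_nonneg_right hs),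
      measure_union (Set.Ioc_disjoint_Ioc_of_le le_rfl) measurableSet_Ioc, hk, add_comm,
      theta_apply _ _ measurableSet_Ioc]
    simp [add_comm]
  have hiff : ∀ s, y + s ∈ hitTimes (n + k) φ ↔ s ∈ hitTimes n (theta y φ) := by
    intro s
    rcases le_or_gt s 0 with hs | hs
    · refine iff_of_false (fun h => ?_) fun h => absurd h.1 (not_lt.2 hs)
      have h1 : ((n + k : ℕ) : ℝ≥0∞) ≤ k :=
        h.2.trans ((measure_mono (Set.Ioc_subset_Ioc_right (by linarith))).trans_eq hk)
      have : n + k ≤ k := by exact_mod_cast h1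
      omega
    · simp only [hitTimes, Set.mem_ofPred_eq, hsplit s hs.le, hs, add_pos_of_nonneg_of_pos hy hs,
        true_and, Nat.cast_add]
      exact ENNReal.add_le_add_iff_right (ENNReal.natCast_ne_top k)
  ext t
  constructor
  · intro h
    exact ⟨t - y, (hiff _).1 (by simpa using h), by simp⟩
  · rintro ⟨s, hs, rfl⟩
    exact (hiff s).2 hs

/-- Shifting to a time `y ≥ 0` and then to the `n`-th point skips the `k` points in `(0, y]`. -/
theorem eta_theta {φ : E} (hφ : φ ∈ Minf) {y : ℝ} (hy : 0 ≤ y) {k n : ℕ} (hn : 0 < n)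
    (hk : φ.toMeasure (Set.Ioc 0 y) = k) : eta n (theta y φ) = eta ((n + k : ℕ) : ℤ) φ := by
  have hφ' : theta y φ ∈ Minf := (theta_mem_Minf_iff y φ).2 hφ
  rw [eta, eta, theta_theta, toReal_T_natCast hφ' hn, toReal_T_natCast hφ (by omega),
    hitTimes_add hy hn hk,
    ← OrderIso.map_csInf' _ (hitTimes_nonempty hφ' n) (bddBelow_hitTimes n _)]
  rfl

theorem eta_mem_Minf_iff (n : ℤ) (φ : E) : eta n φ ∈ Minf ↔ φ ∈ Minf :=
  theta_mem_Minf_iff _ _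

/-- On `M^∞` the event shifts form a semigroup: apply `eta_theta` with `y = T₁ φ` and `k = 1`. -/
theorem eta_natCast_eq_iterate {n : ℕ} (hn : 0 < n) :
    ∀ {φ : E}, φ ∈ Minf → eta n φ = (eta 1)^[n] φ := by
  induction n, hn using Nat.le_induction with
  | base => intro φ _; rfl
  | succ n hn ih =>
    intro φ hφ
    rw [Function.iterate_succ_apply, ← ih ((eta_mem_Minf_iff 1 φ).2 hφ)]
    exact (eta_theta hφ (firstPoint_pos hφ).le hn
      ((toMeasure_Ioc_firstPoint hφ).trans Nat.cast_one.symm)).symm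

theorem measurable_T_one : Measurable (T 1) := by
  refine measurable_of_Iio fun a => ?_
  have h : T 1 ⁻¹' Set.Iio a = ⋃ (q : ℚ) (_ : 0 < q ∧ ((q : ℝ) : EReal) < a),
      {φ : E | 1 ≤ φ.toMeasure (Set.Ioc 0 (q : ℝ))} := by
    ext φ
    have hT : T 1 φ = sInf ((fun t : ℝ => (t : EReal)) '' hitTimes 1 φ) := T_natCast one_pos φ
    simp only [Set.mem_preimage, Set.mem_Iio, hT, sInf_lt_iff, Set.exists_mem_image,
      Set.mem_iUnion, Set.mem_ofPred_eq, exists_prop]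
    constructor
    · rintro ⟨t, ht, hta⟩
      obtain ⟨q, hq1, hq2⟩ := EReal.exists_rat_btwn_of_lt hta
      have hq1' : t < q := by exact_mod_cast hq1
      refine ⟨q, ⟨by exact_mod_cast ht.1.trans hq1', hq2⟩, ?_⟩
      simpa using ht.2.trans (measure_mono (Set.Ioc_subset_Ioc_right hq1'.le))
    · rintro ⟨q, ⟨hq0, hqa⟩, hq⟩
      exact ⟨q, ⟨by exact_mod_cast hq0, by simpa using hq⟩, hqa⟩
  rw [h]
  exact .iUnion fun q => .iUnion fun _ =>
    measurableSet_le measurable_const (measurable_toMeasure_apply measurableSet_Ioc)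

theorem measurable_eta_one : Measurable (eta 1) :=
  measurable_theta_uncurry.comp (measurable_T_one.ereal_toReal.prodMk measurable_id)

/-! ### The invariant `σ`-field -/

theorem eta_one_mem_iff_of_mem_calI {A : Set E} (hA : A ∈ calI) {φ : E} (hφ : φ ∈ Minf) :
    eta 1 φ ∈ A ↔ φ ∈ A := by
  have h := Set.ext_iff.1 hA.2 φ
  exact ⟨fun h' => h.1 ⟨Minf_subset_F (n := 1) one_pos hφ, h'⟩, fun h' => (h.2 h').2⟩

theorem iterate_eta_one_mem_iff_of_mem_calI {A : Set E} (hA : A ∈ calI) (n : ℕ) :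
    ∀ {φ : E}, φ ∈ Minf → ((eta 1)^[n] φ ∈ A ↔ φ ∈ A) := by
  induction n with
  | zero => intro φ _; rfl
  | succ n ih =>
    intro φ hφ
    rw [Function.iterate_succ_apply, ih ((eta_mem_Minf_iff 1 φ).2 hφ),
      eta_one_mem_iff_of_mem_calI hA hφ]

/-- Sets that are invariant under the event shift are invariant under the whole flow: for `y ≥ 0`
and `k` points in `(0, y]`, both `φ` and `θ_y φ` are shifted by iterates of `η₁` to `η_{k+1} φ`. -/
theorem theta_mem_iff_of_mem_calI {A : Set E} (hA : A ∈ calI) (y : ℝ) (φ : E) :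
    theta y φ ∈ A ↔ φ ∈ A := by
  have hsub : A ⊆ Minf := (mem_calMinf_iff.1 hA.1).2
  have key : ∀ (y : ℝ) (φ : E), 0 ≤ y → φ ∈ Minf → (theta y φ ∈ A ↔ φ ∈ A) := by
    intro y φ hy hφ
    obtain ⟨k, hk⟩ := φ.integer_valued (Set.Ioc 0 y) measurableSet_Ioc
    have hfin := φ.bounded_lt_top (Set.Ioc 0 y) measurableSet_Ioc (Metric.isBounded_Ioc _ _)
    induction k using ENat.recTopCoe with
    | top => simp [hk] at hfin
    | coe k =>
      have hη : eta 1 (theta y φ) = eta ((1 + k : ℕ) : ℤ) φ :=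
        eta_theta hφ hy (n := 1) one_pos (by simpa using hk)
      rw [← eta_one_mem_iff_of_mem_calI hA ((theta_mem_Minf_iff y φ).2 hφ), hη,
        eta_natCast_eq_iterate (by omega) hφ, iterate_eta_one_mem_iff_of_mem_calI hA _ hφ]
  by_cases hφ : φ ∈ Minf
  · rcases le_total 0 y with hy | hy
    · exact key y φ hy hφ
    · have h := key (-y) (theta y φ) (by linarith) ((theta_mem_Minf_iff y φ).2 hφ)
      rw [theta_theta, add_neg_cancel, theta_zero] at h
      exact h.symm
  · exact iff_of_false (fun h => hφ ((theta_mem_Minf_iff y φ).1 (hsub h))) fun h => hφ (hsub h)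

/-- A measurable set of `E` that is invariant under the total map `eta 1` has its trace on `M^∞` in
the invariant `σ`-field. -/
theorem inter_Minf_mem_calI {S : Set E} (hS : MeasurableSet S)
    (hinv : ∀ φ, eta 1 φ ∈ S ↔ φ ∈ S) : S ∩ Minf ∈ calI := by
  refine ⟨mem_calMinf_iff.2 ⟨hS.inter measurableSet_Minf, Set.inter_subset_right⟩, ?_⟩
  ext φ
  constructor
  · rintro ⟨-, hS', hM⟩
    exact ⟨(hinv φ).1 hS', (eta_mem_Minf_iff 1 φ).1 hM⟩
  · rintro ⟨hS', hM⟩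
    exact ⟨Minf_subset_F (n := 1) one_pos hM, (hinv φ).2 hS', (eta_mem_Minf_iff 1 φ).2 hM⟩

theorem Minf_mem_calI : Minf ∈ calI := by
  simpa using inter_Minf_mem_calI MeasurableSet.univ fun φ => by simp

/-! ### Event averages -/

theorem mem_etaPreimage_iff {n : ℕ} (hn : 0 < n) {A : Set E} {φ : E} (hφ : φ ∈ Minf) :
    φ ∈ etaPreimage n A ↔ (eta 1)^[n] φ ∈ A := by
  rw [← eta_natCast_eq_iterate hn hφ]
  exact ⟨fun h => h.2, fun h => ⟨Minf_subset_F hn hφ, h⟩⟩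

theorem measureReal_etaPreimage {P : Measure E} [IsProbabilityMeasure P] (hP : P Minf = 1) {n : ℕ}
    (hn : 0 < n) (A : Set E) : P.real (etaPreimage n A) = P.real ((eta 1)^[n] ⁻¹' A) := by
  refine measureReal_congr ?_
  filter_upwards [ae_mem_Minf hP] with φ hφ
  exact propext (mem_etaPreimage_iff hn hφ)

/-- An event-stationary distribution is preserved by `eta 1` as a map on all of `E`, because the
complement of `M^∞` is null. -/
theorem measurePreserving_eta_one {P : Measure E} (hP : IsES P) :
    MeasurePreserving (eta 1) P P := by
  have := hP.isDistribution.isProbabilityMeasure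
  refine ⟨measurable_eta_one, Measure.ext fun B hB => ?_⟩
  have hae := ae_mem_Minf hP.infinite
  rw [Measure.map_apply measurable_eta_one hB]
  calc P (eta 1 ⁻¹' B) = P (etaPreimage 1 (B ∩ Minf)) := by
        refine measure_congr ?_
        filter_upwards [hae] with φ hφ
        refine propext ((mem_etaPreimage_iff (n := 1) one_pos hφ).trans ?_).symm
        exact and_iff_left ((eta_mem_Minf_iff 1 φ).2 hφ)
    _ = P (B ∩ Minf) :=
        hP.invariant _ (mem_calMinf_iff.2 ⟨hB.inter measurableSet_Minf, Set.inter_subset_right⟩)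
    _ = P B := measure_inter_Minf hP.infinite B

theorem integral_birkhoffAverage_eta {P : Measure E} [IsProbabilityMeasure P] (hP : P Minf = 1)
    {A : Set E} (hA : MeasurableSet A) (n : ℕ) :
    ∫ φ, birkhoffAverage ℝ (eta 1) ((eta 1 ⁻¹' A).indicator 1) n φ ∂P =
      (1 / (n : ℝ)) * ∑ i ∈ Finset.Icc 1 n, P.real (etaPreimage (i : ℤ) A) := by
  have hmeas : ∀ k : ℕ, MeasurableSet ((eta 1)^[k] ⁻¹' (eta 1 ⁻¹' A)) := fun k =>
    (measurable_eta_one.iterate k) (measurable_eta_one hA)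
  have hcomp : ∀ (k : ℕ) (φ : E), (eta 1 ⁻¹' A).indicator (1 : E → ℝ) ((eta 1)^[k] φ) =
      ((eta 1)^[k] ⁻¹' (eta 1 ⁻¹' A)).indicator 1 φ := fun k φ => rfl
  have hint : ∀ k : ℕ, Integrable (((eta 1)^[k] ⁻¹' (eta 1 ⁻¹' A)).indicator (1 : E → ℝ)) P :=
    fun k => (integrable_const (1 : ℝ)).indicator (hmeas k)
  simp only [birkhoffAverage, birkhoffSum, smul_eq_mul, hcomp]
  rw [integral_const_mul, integral_finsetSum _ fun k _ => hint k, one_div,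
    ← Finset.Ico_add_one_right_eq_Icc, Finset.sum_Ico_eq_sum_range]
  congr 1
  refine Finset.sum_congr rfl fun k _ => ?_
  rw [integral_indicator_one (hmeas k), measureReal_etaPreimage hP (by omega), add_comm 1 k,
    Function.iterate_succ', Set.preimage_comp]

theorem isEAMS_of_agreeOnInvariant {P Q : Measure E} (hP : IsDistribution P)
    (hPinf : P Minf = 1) (hQ : IsES Q) (h : AgreeOnInvariant P Q) : IsEAMS P Q := by
  have := hP.isProbabilityMeasure
  have := hQ.isDistribution.isProbabilityMeasure
  refine ⟨hPinf, hQ.isDistribution, hQ.infinite, fun A hA => ?_⟩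
  have hA' : MeasurableSet A := (mem_calMinf_iff.1 hA).1
  have hτ := measurePreserving_eta_one hQ
  -- The event averages start at `i = 1`, so the averaged function is `1_A ∘ η₁` rather than `1_A`.
  let f : E → ℝ := (eta 1 ⁻¹' A).indicator 1
  have hfm : Measurable f := measurable_one.indicator (measurable_eta_one hA')
  have hf1 : ∀ φ, |f φ| ≤ 1 := abs_indicator_one_le _
  obtain ⟨l, hl⟩ := exists_tendstoInMeasure_birkhoffAverage hτ
    (MemLp.of_bound hfm.aestronglyMeasurable 1 (ae_of_all _ hf1))
  simp only [← integral_birkhoffAverage_eta hPinf hA']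
  refine tendsto_integral_of_agree_on_invariant (R := fun φ ψ => φ = eta 1 ψ)
    (measurable_birkhoffAverage measurable_eta_one hfm) (abs_birkhoffAverage_le hf1) hl ?_ ?_ ?_
  · rintro _ φ rfl
    refine tendsto_birkhoffAverage_apply_sub_birkhoffAverage' ℝ ?_ (eta 1) φ
    exact isBounded_iff_forall_norm_le.2 ⟨1, by rintro _ ⟨ψ, rfl⟩; exact hf1 ψ⟩
  · intro S hS hinv
    have hmem := h _ (inter_Minf_mem_calI hS fun φ => hinv _ φ rfl)
    rwa [measure_inter_Minf hPinf, measure_inter_Minf hQ.infinite] at hmem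
  · filter_upwards [eventually_gt_atTop 0] with n hn
    rw [integral_birkhoffAverage_eta hQ.infinite hA']
    have hterm : ∀ i ∈ Finset.Icc 1 n, Q.real (etaPreimage (i : ℤ) A) = Q.real A := by
      intro i hi
      rw [measureReal_etaPreimage hQ.infinite (Finset.mem_Icc.1 hi).1, measureReal_def,
        (hτ.iterate i).measure_preimage hA'.nullMeasurableSet, measureReal_def]
    rw [Finset.sum_congr rfl hterm]
    have : (n : ℝ) ≠ 0 := by positivity
    simp [this]

theorem agreeOnInvariant_of_isEAMS {P Q : Measure E} [IsProbabilityMeasure P]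
    [IsProbabilityMeasure Q] (h : IsEAMS P Q) : AgreeOnInvariant P Q := by
  intro A hA
  have hconst : ∀ᶠ n : ℕ in atTop,
      (1 / (n : ℝ)) * ∑ i ∈ Finset.Icc 1 n, P.real (etaPreimage (i : ℤ) A) = P.real A := by
    filter_upwards [eventually_gt_atTop 0] with n hn
    have hterm : ∀ i ∈ Finset.Icc 1 n, P.real (etaPreimage (i : ℤ) A) = P.real A := by
      intro i hi
      rw [measureReal_etaPreimage h.infinite (Finset.mem_Icc.1 hi).1]
      refine measureReal_congr ?_
      filter_upwards [ae_mem_Minf h.infinite] with φ hφ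
      exact propext (iterate_eta_one_mem_iff_of_mem_calI hA i hφ)
    rw [Finset.sum_congr rfl hterm]
    have : (n : ℝ) ≠ 0 := by positivity
    simp [this]
  have := tendsto_nhds_unique (tendsto_const_nhds.congr' (hconst.mono fun _ h => h.symm))
    (h.tendsto A hA.1)
  exact (measureReal_eq_measureReal_iff).1 this

/-! ### Time averages -/

/-- The fraction of the shifts `θ_y φ`, `0 ≤ y ≤ x`, that belong to `A`. -/
noncomputable def timeAverage (A : Set E) (x : ℝ) (φ : E) : ℝ :=
  x⁻¹ * ∫ y in (0 : ℝ)..x, A.indicator 1 (theta y φ)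

theorem measurable_indicator_theta {A : Set E} (hA : MeasurableSet A) :
    Measurable fun p : ℝ × E => A.indicator (1 : E → ℝ) (theta p.1 p.2) :=
  (measurable_one.indicator hA).comp measurable_theta_uncurry

theorem intervalIntegrable_indicator_theta {A : Set E} (hA : MeasurableSet A) (φ : E) (a b : ℝ) :
    IntervalIntegrable (fun y => A.indicator (1 : E → ℝ) (theta y φ)) volume a b :=
  (intervalIntegrable_const (c := (1 : ℝ))).mono_fun
    ((measurable_indicator_theta hA).comp measurable_prodMk_right).aestronglyMeasurable
    (ae_of_all _ fun y => by simpa using abs_indicator_one_le A (theta y φ))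

theorem norm_integral_indicator_theta_le (A : Set E) (φ : E) (a b : ℝ) :
    ‖∫ y in a..b, A.indicator (1 : E → ℝ) (theta y φ)‖ ≤ |b - a| := by
  rw [← one_mul |b - a|]
  exact intervalIntegral.norm_integral_le_of_norm_le_const
    fun y _ => abs_indicator_one_le A (theta y φ)

theorem abs_timeAverage_le (A : Set E) {x : ℝ} (hx : 0 ≤ x) (φ : E) :
    |timeAverage A x φ| ≤ 1 := by
  have h := norm_integral_indicator_theta_le A φ 0 x
  rw [sub_zero, abs_of_nonneg hx, Real.norm_eq_abs] at h
  rw [timeAverage, abs_mul, abs_inv, abs_of_nonneg hx]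
  exact inv_mul_le_one_of_le₀ h hx

theorem measurable_timeAverage {A : Set E} (hA : MeasurableSet A) {x : ℝ} (hx : 0 ≤ x) :
    Measurable (timeAverage A x) := by
  unfold timeAverage
  simp only [intervalIntegral.integral_of_le hx]
  have hmeas := (measurable_indicator_theta hA).stronglyMeasurable.integral_prod_left'
    (μ := volume.restrict (Set.Ioc 0 x))
  exact hmeas.measurable.const_mul _

/-- Time averages are asymptotically invariant under the flow: shifting the window `[0, n]` by `s`
changes the integral by at most `2 |s|`. -/
theorem timeAverage_theta_sub {A : Set E} (hA : MeasurableSet A) (s : ℝ) (φ : E) :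
    Tendsto (fun n : ℕ => timeAverage A n (theta s φ) - timeAverage A n φ) atTop (𝓝 0) := by
  have hlim : Tendsto (fun n : ℕ => (2 * |s|) / (n : ℝ)) atTop (𝓝 0) :=
    tendsto_const_nhds.div_atTop tendsto_natCast_atTop_atTop
  refine squeeze_zero_norm (fun n => ?_) hlim
  have hint := intervalIntegrable_indicator_theta hA φ
  have hshift : ∫ y in (0 : ℝ)..n, A.indicator (1 : E → ℝ) (theta y (theta s φ)) =
      ∫ y in s..n + s, A.indicator (1 : E → ℝ) (theta y φ) := by
    simp only [theta_theta, add_comm s]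
    rw [intervalIntegral.integral_comp_add_right
      (fun y => A.indicator (1 : E → ℝ) (theta y φ)) s, zero_add]
  rw [timeAverage, timeAverage, hshift, ← mul_sub,
    intervalIntegral.integral_interval_sub_interval_comm' (hint _ _) (hint _ _) (hint _ _),
    norm_mul, norm_inv, RCLike.norm_natCast, div_eq_inv_mul]
  gcongr
  refine (norm_sub_le _ _).trans ?_
  have h1 := norm_integral_indicator_theta_le A φ n (n + s)
  have h2 := norm_integral_indicator_theta_le A φ 0 s
  rw [add_sub_cancel_left] at h1
  rw [sub_zero] at h2
  linarith

theorem iterate_theta_one (n : ℕ) (φ : E) : (theta 1)^[n] φ = theta n φ := by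
  induction n with
  | zero => simp [theta_zero]
  | succ n ih =>
    rw [Function.iterate_succ_apply', ih, theta_theta, Nat.cast_succ]

theorem birkhoffAverage_timeAverage {A : Set E} (hA : MeasurableSet A) (n : ℕ) (φ : E) :
    birkhoffAverage ℝ (theta 1) (timeAverage A 1) n φ = timeAverage A n φ := by
  have hterm : ∀ k : ℕ, timeAverage A 1 (theta k φ) =
      ∫ y in (k : ℝ)..(k + 1 : ℕ), A.indicator (1 : E → ℝ) (theta y φ) := by
    intro k
    simp only [timeAverage, theta_theta, inv_one, one_mul]
    rw [intervalIntegral.integral_comp_add_left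
      (fun y => A.indicator (1 : E → ℝ) (theta y φ)) (k : ℝ)]
    simp
  have hsum := intervalIntegral.sum_integral_adjacent_intervals (a := fun k : ℕ => (k : ℝ)) (n := n)
    fun k _ => intervalIntegrable_indicator_theta hA φ k (k + 1 : ℕ)
  simp only [birkhoffAverage, birkhoffSum, iterate_theta_one, hterm, hsum, smul_eq_mul,
    Nat.cast_zero]
  rfl

theorem integral_timeAverage {P : Measure E} [IsProbabilityMeasure P] {A : Set E}
    (hA : MeasurableSet A) (x : ℝ) :
    ∫ φ, timeAverage A x φ ∂P = (1 / x) * ∫ y in (0 : ℝ)..x, P.real (theta y ⁻¹' A) := by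
  have : IsFiniteMeasure (volume.restrict (Set.uIoc 0 x)) := ⟨by simp [Set.uIoc]⟩
  have hint : Integrable (Function.uncurry fun (y : ℝ) (φ : E) =>
      A.indicator (1 : E → ℝ) (theta y φ)) ((volume.restrict (Set.uIoc 0 x)).prod P) :=
    Integrable.of_bound (measurable_indicator_theta hA).aestronglyMeasurable 1
      (ae_of_all _ fun p => abs_indicator_one_le A _)
  simp only [timeAverage]
  rw [integral_const_mul, ← intervalIntegral_integral_swap hint, one_div]
  congr 1
  refine intervalIntegral.integral_congr fun y _ => ?_
  exact integral_indicator_one (measurable_theta y hA)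

theorem measurable_measureReal_theta_preimage {P : Measure E} [IsProbabilityMeasure P] {A : Set E}
    (hA : MeasurableSet A) : Measurable fun y : ℝ => P.real (theta y ⁻¹' A) :=
  (measurable_measure_prodMk_left (measurable_theta_uncurry hA)).ennreal_toReal

theorem measurePreserving_theta {P : Measure E} (hP : IsTS P) (y : ℝ) :
    MeasurePreserving (theta y) P P := by
  have := hP.isDistribution.isProbabilityMeasure
  have hnull : P Mᶜ = 0 := (prob_compl_eq_zero_iff measurableSet_M).2 hP.isDistribution.simple
  refine ⟨measurable_theta y, Measure.ext fun B hB => ?_⟩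
  have hpre : theta y ⁻¹' (B ∩ M) = theta y ⁻¹' B ∩ M := by
    ext φ
    exact and_congr_right fun _ => theta_mem_M_iff y φ
  rw [Measure.map_apply (measurable_theta y) hB, ← measure_inter_conull hnull, ← hpre,
    hP.invariant y _ (mem_calM_iff.2 ⟨hB.inter measurableSet_M, Set.inter_subset_right⟩),
    measure_inter_conull hnull]

theorem isTAMS_of_agreeOnInvariant {P Q : Measure E} (hP : IsDistribution P)
    (hPinf : P Minf = 1) (hQ : IsTS Q) (h : AgreeOnInvariant P Q) : IsTAMS P Q := by
  have := hP.isProbabilityMeasure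
  have := hQ.isDistribution.isProbabilityMeasure
  -- `M^∞` itself is invariant, so the mass that `P` gives it carries over to `Q`.
  have hQinf : Q Minf = 1 := (h _ Minf_mem_calI).symm.trans hPinf
  refine ⟨hQ.isDistribution, fun A hA => ?_⟩
  have hA' : MeasurableSet A := measurableSet_of_mem_calM hA
  refine tendsto_average_of_tendsto_natCast (measurable_measureReal_theta_preimage hA')
    (fun y => by rw [abs_of_nonneg measureReal_nonneg]; exact measureReal_le_one) ?_
  simp only [← integral_timeAverage (P := P) hA']
  obtain ⟨l, hl⟩ := exists_tendstoInMeasure_birkhoffAverage (measurePreserving_theta hQ 1)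
    (MemLp.of_bound (measurable_timeAverage hA' zero_le_one).aestronglyMeasurable 1
      (ae_of_all _ (abs_timeAverage_le A zero_le_one)))
  have hl' : TendstoInMeasure Q (fun n : ℕ => timeAverage A n) atTop l :=
    hl.congr_left fun n => ae_of_all _ (birkhoffAverage_timeAverage hA' n)
  refine tendsto_integral_of_agree_on_invariant (R := fun φ ψ => ∃ s, φ = theta s ψ)
    (fun n => measurable_timeAverage hA' n.cast_nonneg)
    (fun n => abs_timeAverage_le A n.cast_nonneg) hl' ?_ ?_ ?_
  · rintro _ φ ⟨s, rfl⟩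
    exact timeAverage_theta_sub hA' s φ
  · intro S hS hinv
    have hmem := h _ (inter_Minf_mem_calI hS fun φ => hinv _ φ ⟨_, rfl⟩)
    rwa [measure_inter_Minf hPinf, measure_inter_Minf hQinf] at hmem
  · filter_upwards [eventually_gt_atTop 0] with n hn
    have hconst : ∀ y : ℝ, Q.real (theta y ⁻¹' A) = Q.real A := fun y =>
      congrArg ENNReal.toReal (hQ.invariant y A hA)
    have : (n : ℝ) ≠ 0 := by positivity
    rw [integral_timeAverage hA']
    simp [hconst, this]

theorem agreeOnInvariant_of_isTAMS {P Q : Measure E} [IsProbabilityMeasure P]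
    [IsProbabilityMeasure Q] (h : IsTAMS P Q) : AgreeOnInvariant P Q := by
  intro A hA
  have hA' := mem_calMinf_iff.1 hA.1
  have hconst : ∀ y : ℝ, P.real (theta y ⁻¹' A) = P.real A := fun y =>
    congrArg P.real (Set.ext fun φ => theta_mem_iff_of_mem_calI hA y φ)
  have hlim := h.tendsto A (mem_calM_iff.2 ⟨hA'.1, hA'.2.trans Minf_subset_M⟩)
  have hev : ∀ᶠ x : ℝ in atTop,
      P.real A = (1 / x) * ∫ y in (0 : ℝ)..x, P.real (theta y ⁻¹' A) := by
    filter_upwards [eventually_gt_atTop 0] with x hx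
    simp [hconst, hx.ne']
  exact (measureReal_eq_measureReal_iff).1
    (tendsto_nhds_unique (tendsto_const_nhds.congr' hev) hlim)

end PointProcess

theorem theorem4p1 (P Pes Pts : MeasureTheory.Measure PointProcess.E)
    (hP : PointProcess.IsDistribution P) (hPinf : P PointProcess.Minf = 1)
    (hes : PointProcess.IsES Pes) (hts : PointProcess.IsTS Pts) :
    (PointProcess.IsEAMS P Pes ↔ PointProcess.AgreeOnInvariant P Pes) ∧
      (PointProcess.IsTAMS P Pts ↔ PointProcess.AgreeOnInvariant P Pts) := by
  have := hP.isProbabilityMeasure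
  have := hes.isDistribution.isProbabilityMeasure
  have := hts.isDistribution.isProbabilityMeasure
  exact ⟨⟨PointProcess.agreeOnInvariant_of_isEAMS,
      PointProcess.isEAMS_of_agreeOnInvariant hP hPinf hes⟩,
    ⟨PointProcess.agreeOnInvariant_of_isTAMS,
      PointProcess.isTAMS_of_agreeOnInvariant hP hPinf hts⟩⟩
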